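/- A $0/1$-polytope is the convex hull $P=\operatorname{conv}(V)\subseteq\mathbb{R}^n$ of a set $V\subseteq\{0,1\}^n$, for some $n\ge 0$; its dimension is the dimension of its affine hull. A face of $P$ is a set of the form $\{x\in P : c^{t}x=\gamma\}$, where $c\in\mathbb{R}^n$, $\gamma\in\mathbb{R}$ and the inequality $c^{t}x\le\gamma$ holds for all $x\in P$; a facet of $P$ is a nonempty face of dimension $\dim P-1$. For an integer $d\ge 1$, let $\#f(d)$ denote the maximal number of facets of a $d$-dimensional $0/1$-polytope. Then $$\#f(d)\ \le\ 2\,(d-1)!\,+\,2(d-1),$$ that is, every $d$-dimensional $0/1$-polytope has at most $2(d-1)!+2(d-1)$ facets. -/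

import Mathlib

namespace ZeroOne

/-- A 0/1-polytope in `ℝⁿ`: the convex hull of a set of 0/1-vectors. -/
def IsZeroOnePolytope {n : ℕ} (P : Set (Fin n → ℝ)) : Prop :=
  ∃ V : Set (Fin n → ℝ), (∀ v ∈ V, ∀ i, v i = 0 ∨ v i = 1) ∧ P = convexHull ℝ V

/-- `P` is nonempty and its affine hull has dimension `k` (so the empty set has no dimension
`k : ℕ`). -/
def HasDim {n : ℕ} (P : Set (Fin n → ℝ)) (k : ℕ) : Prop :=
  P.Nonempty ∧ Module.finrank ℝ (vectorSpan ℝ P) = k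

/-- `F` is a face of `P`: the set of points of `P` at which some linear inequality valid on `P`
is tight. This includes the trivial faces `∅` and `P`. -/
def IsFace {n : ℕ} (P F : Set (Fin n → ℝ)) : Prop :=
  ∃ (c : Fin n → ℝ) (γ : ℝ), (∀ x ∈ P, c ⬝ᵥ x ≤ γ) ∧ F = {x ∈ P | c ⬝ᵥ x = γ}

/-- The facets of `P`: its nonempty faces of dimension `dim P - 1`. -/
def facets {n : ℕ} (P : Set (Fin n → ℝ)) : Set (Set (Fin n → ℝ)) :=
  {F | IsFace P F ∧ ∃ k : ℕ, HasDim F k ∧ HasDim P (k + 1)}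

/-- The maximal number of facets of a `d`-dimensional 0/1-polytope (in any `ℝⁿ`), as a supremum
in `ℕ∞`; a finite upper bound thus includes that each such polytope has finitely many facets. -/
noncomputable def maxFacets (d : ℕ) : ℕ∞ :=
  ⨆ (n : ℕ) (P : Set (Fin n → ℝ)) (_ : IsZeroOnePolytope P) (_ : HasDim P d), (facets P).encard

end ZeroOne

namespace ZeroOne

open MeasureTheory

/-! Choose coordinates so that the polytope is full-dimensional in `ℝᵐ⁺¹`, with `m = d - 1`, and
project along the last axis. The upper facets project to full-dimensional 0/1-polytopes in the unit
cube of `ℝᵐ` with disjoint interiors. Each has volume at least `1 / m!`, so there are at most `m!`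
of them; likewise for the lower facets. A vertical facet has a flat projection. If its inequality
holds on the whole cube, it lies in one of the `2m` vertical cube facets. Otherwise some cube vertex
violates it, and the pyramid over the projection whose apex is the first such vertex is again
full-dimensional. These pyramids overlap neither one another nor the projected upper facets, so they
are counted within the same `m!` (`exists_separating`, `card_le_factorial_of_separated`). The total
is `m! + m! + 2m`. -/

/-! ### Volumes of 0/1-polytopes -/

/-- The corner simplex `{x ≥ 0, ∑ xᵢ ≤ 1}`. -/
def cornerSimplex (m : ℕ) : Set (Fin m → ℝ) := {x | (∀ i, 0 ≤ x i) ∧ ∑ i, x i ≤ 1}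

theorem volume_crossPolytope (m : ℕ) :
    volume {x : Fin m → ℝ | ∑ i, |x i| ≤ 1} = ENNReal.ofReal (2 ^ m / m.factorial) := by
  rcases Nat.eq_zero_or_pos m with rfl | hm
  · have : {x : Fin 0 → ℝ | ∑ i, |x i| ≤ 1} = Set.univ := by ext; simp
    rw [this]
    simp [Measure.volume_pi_eq_dirac 0]
  · have : Nonempty (Fin m) := ⟨⟨0, hm⟩⟩
    have h := volume_sum_rpow_le (ι := Fin m) (p := 1) le_rfl 1
    have h2 : Real.Gamma (1 + 1) = 1 := by
      rw [show (1 : ℝ) + 1 = 2 by norm_num]; exact Real.Gamma_two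
    simpa [Real.Gamma_nat_eq_factorial, h2] using h

/-- The `2 ^ m` sign reflections of the corner simplex preserve volume and cover the cross-polytope.
-/
theorem volume_cornerSimplex_ge (m : ℕ) :
    ENNReal.ofReal (1 / m.factorial) ≤ volume (cornerSimplex m) := by
  let D : (Fin m → Bool) → ((Fin m → ℝ) →ₗ[ℝ] (Fin m → ℝ)) :=
    fun s => Matrix.toLin' (Matrix.diagonal fun i => if s i then (1 : ℝ) else -1)
  have hD : ∀ s, |LinearMap.det (D s)| = 1 := by
    intro s
    rw [LinearMap.det_toLin', Matrix.det_diagonal, Finset.abs_prod]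
    exact Finset.prod_eq_one fun i _ => by split_ifs <;> simp
  have hcov : {x : Fin m → ℝ | ∑ i, |x i| ≤ 1} ⊆ ⋃ s, D s '' cornerSimplex m := by
    intro x hx
    refine Set.mem_iUnion.2 ⟨fun i => decide (0 ≤ x i), fun i => |x i|, ⟨fun i => abs_nonneg _, hx⟩,
      ?_⟩
    ext i
    simp only [D, Matrix.toLin'_apply, Matrix.mulVec_diagonal]
    by_cases h : 0 ≤ x i
    · simp [h, abs_of_nonneg h]
    · simp [h, abs_of_neg (not_le.1 h)]
  have h1 : ENNReal.ofReal (2 ^ m / m.factorial) ≤ 2 ^ m * volume (cornerSimplex m) := by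
    rw [← volume_crossPolytope]
    refine (measure_mono hcov).trans ((measure_iUnion_fintype_le _ _).trans ?_)
    simp [Measure.addHaar_image_linearMap, hD]
  have h2 : ENNReal.ofReal (2 ^ m / m.factorial) = 2 ^ m * ENNReal.ofReal (1 / m.factorial) := by
    rw [div_eq_mul_one_div, ENNReal.ofReal_mul (by positivity), ENNReal.ofReal_pow (by norm_num)]
    simp
  rw [h2] at h1
  exact (ENNReal.mul_le_mul_iff_right (by simp) (by simp)).1 h1

/-- A 0/1-polytope of full dimension in `ℝᵐ` has volume at least `1 / m!`. -/
theorem volume_convexHull_ge {m : ℕ} {T : Set (Fin m → ℝ)}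
    (h01 : ∀ v ∈ T, ∀ i, v i = 0 ∨ v i = 1) (hne : T.Nonempty) (hT : vectorSpan ℝ T = ⊤) :
    ENNReal.ofReal (1 / m.factorial) ≤ volume (convexHull ℝ T) := by
  obtain ⟨p, hp⟩ := hne
  have hspan : Submodule.span ℝ (Set.range fun v : T => v.1 - p) = ⊤ := by
    rw [← hT, vectorSpan_eq_span_vsub_set_right ℝ hp]
    congr 1
    ext y
    simp
  obtain ⟨κ, a, -, hs, hli⟩ := exists_linearIndependent' ℝ (fun v : T => v.1 - p)
  rw [hspan] at hs
  let b := Module.Basis.mk hli hs.ge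
  have : Fintype κ := FiniteDimensional.fintypeBasisIndex b
  have hcard : Fintype.card κ = m := by
    rw [← Module.finrank_eq_card_basis b]; simp
  let e : Fin m ≃ κ := (Fintype.equivFinOfCardEq hcard).symm
  let q : Fin m → (Fin m → ℝ) := fun j => (a (e j)).1
  have hq : ∀ j, q j ∈ T := fun j => (a (e j)).2
  let A : Matrix (Fin m) (Fin m) ℝ := Matrix.of fun i j => q j i - p i
  have hcol : LinearIndependent ℝ A.col := by
    have := hli.comp e e.injective
    exact this
  have hdet : A.det ≠ 0 := by
    have := (Matrix.linearIndependent_cols_iff_isUnit).1 hcol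
    exact ((Matrix.isUnit_iff_isUnit_det A).1 this).ne_zero
  -- A nonzero integer determinant has absolute value at least one; this is where 0/1 coordinates
  -- enter the volume bound.
  have hint : ∃ z : ℤ, A.det = z := by
    have h : ∀ v ∈ T, ∀ i, ∃ z : ℤ, v i = z := fun v hv i => by
      rcases h01 v hv i with h | h
      · exact ⟨0, by simpa using h⟩
      · exact ⟨1, by simpa using h⟩
    have hA : ∀ i j, ∃ z : ℤ, A i j = z := fun i j => by
      obtain ⟨y, hy⟩ := h _ (hq j) i
      obtain ⟨z, hz⟩ := h _ hp i
      exact ⟨y - z, by simp [A, hy, hz]⟩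
    choose B hB using hA
    refine ⟨(Matrix.of B).det, ?_⟩
    have : A = (Int.castRingHom ℝ).mapMatrix (Matrix.of B) := by
      ext i j; simp [hB]
    rw [this, ← RingHom.map_det]
    simp
  have hdet1 : 1 ≤ |A.det| := by
    obtain ⟨z, hz⟩ := hint
    rw [hz] at hdet ⊢
    have : z ≠ 0 := by exact_mod_cast hdet
    exact_mod_cast Int.one_le_abs this
  have hsub : (fun x => p + x) '' (Matrix.toLin' A '' cornerSimplex m) ⊆ convexHull ℝ T := by
    rintro _ ⟨_, ⟨x, ⟨hx0, hx1⟩, rfl⟩, rfl⟩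
    -- `none` stands for the base vertex `p`, which takes the remaining weight `1 - ∑ xᵢ`.
    have hmem : ∑ o : Option (Fin m), (o.elim (1 - ∑ i, x i) x) • (o.elim p q) ∈
        convexHull ℝ T := by
      refine (convex_convexHull ℝ T).sum_mem ?_ ?_ ?_
      · rintro (_ | i) -
        · simpa using hx1
        · exact hx0 i
      · simp [Fintype.sum_option]
      · rintro (_ | i) -
        · exact subset_convexHull ℝ T hp
        · exact subset_convexHull ℝ T (hq i)
    convert hmem using 1
    ext i
    simp only [Fintype.sum_option, Option.elim, Matrix.toLin'_apply, Matrix.mulVec, dotProduct, A,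
      Matrix.of_apply, Pi.add_apply, Finset.sum_apply, Pi.smul_apply, smul_eq_mul, sub_mul,
      Finset.sum_sub_distrib, Finset.sum_mul, ← Finset.mul_sum, one_mul]
    have : ∑ j, x j * q j i = ∑ j, q j i * x j := Finset.sum_congr rfl fun _ _ => mul_comm _ _
    rw [this, ← Finset.sum_mul]
    ring
  calc ENNReal.ofReal (1 / m.factorial) ≤ volume (cornerSimplex m) := volume_cornerSimplex_ge m
    _ ≤ ENNReal.ofReal |A.det| * volume (cornerSimplex m) := by
        refine le_mul_of_one_le_left zero_le ?_
        simpa using hdet1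
    _ = volume ((fun x => p + x) '' (Matrix.toLin' A '' cornerSimplex m)) := by
        rw [Set.image_add_left, measure_preimage_add, Measure.addHaar_image_linearMap,
          LinearMap.det_toLin']
    _ ≤ _ := measure_mono hsub

theorem volume_hyperplane_eq_zero {m : ℕ} {a : Fin m → ℝ} {b : ℝ} (h : ¬(a = 0 ∧ b = 0)) :
    volume {x : Fin m → ℝ | a ⬝ᵥ x = b} = 0 := by
  by_cases ha : a = 0
  · have hb : b ≠ 0 := fun hb => h ⟨ha, hb⟩
    have : {x : Fin m → ℝ | a ⬝ᵥ x = b} = ∅ := by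
      ext x; simp [ha, hb.symm]
    simp [this]
  · rcases Set.eq_empty_or_nonempty {x : Fin m → ℝ | a ⬝ᵥ x = b} with h0 | ⟨p, hp⟩
    · simp [h0]
    · have hsub : {x : Fin m → ℝ | a ⬝ᵥ x = b} ⊆
          (AffineSubspace.mk' p (LinearMap.ker (dotProductBilin ℝ ℝ a)) :
            AffineSubspace ℝ (Fin m → ℝ)) := by
        intro x hx
        simp only [Set.mem_ofPred_eq] at hx hp
        simp [AffineSubspace.mem_mk', dotProduct_sub, hx, hp]
      refine measure_mono_null hsub (Measure.addHaar_affineSubspace _ _ fun htop => ?_)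
      have := congrArg AffineSubspace.direction htop
      rw [AffineSubspace.direction_mk', AffineSubspace.direction_top] at this
      have h2 : a ∈ LinearMap.ker (dotProductBilin ℝ ℝ a) := this ▸ Submodule.mem_top
      exact ha (dotProduct_self_eq_zero.1 (by simpa using h2))

/-- Full-dimensional 0/1-polytopes in `ℝᵐ` that are pairwise separated by hyperplanes number at
most `m!`. -/
theorem card_le_factorial_of_separated {ι : Type*} {m : ℕ} (I : Finset ι)
    (T : ι → Set (Fin m → ℝ)) (h01 : ∀ k ∈ I, ∀ v ∈ T k, ∀ i, v i = 0 ∨ v i = 1)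
    (hne : ∀ k ∈ I, (T k).Nonempty) (hT : ∀ k ∈ I, vectorSpan ℝ (T k) = ⊤)
    (hsep : ∀ k ∈ I, ∀ l ∈ I, k ≠ l → ∃ (a : Fin m → ℝ) (b : ℝ), ¬(a = 0 ∧ b = 0) ∧
      (∀ v ∈ T k, a ⬝ᵥ v ≤ b) ∧ ∀ v ∈ T l, b ≤ a ⬝ᵥ v) :
    I.card ≤ m.factorial := by
  have hlin : ∀ a : Fin m → ℝ, IsLinearMap ℝ fun x => a ⬝ᵥ x := fun a =>
    ⟨fun x y => dotProduct_add _ _ _, fun r x => dotProduct_smul _ _ _⟩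
  have hdisj : Set.Pairwise (I : Set ι)
      (Function.onFun (AEDisjoint volume) fun k => convexHull ℝ (T k)) := by
    intro k hk l hl hkl
    obtain ⟨a, b, hab, h1, h2⟩ := hsep k hk l hl hkl
    refine measure_mono_null (fun x hx => ?_) (volume_hyperplane_eq_zero hab)
    exact le_antisymm (convexHull_min h1 (convex_halfSpace_le (hlin a) b) hx.1)
      (convexHull_min h2 (convex_halfSpace_ge (hlin a) b) hx.2)
  have hfin : ∀ k ∈ I, (T k).Finite := fun k hk =>
    (Set.Finite.pi' (fun _ : Fin m => Set.toFinite ({0, 1} : Set ℝ))).subset fun v hv i => by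
      simpa using h01 k hk v hv i
  have hsum := measure_biUnion_finset₀ hdisj fun k hk =>
    ((hfin k hk).isCompact_convexHull (𝕜 := ℝ)).isClosed.measurableSet.nullMeasurableSet
  have hle : volume (⋃ k ∈ I, convexHull ℝ (T k)) ≤ 1 := by
    have hcube : volume (Set.Icc (0 : Fin m → ℝ) 1) = 1 := by simp [Real.volume_Icc_pi]
    rw [← hcube]
    refine measure_mono (Set.iUnion₂_subset fun k hk => convexHull_min (fun v hv => ?_)
      (convex_Icc _ _))
    constructor <;> intro i <;> rcases h01 k hk v hv i with h | h <;> simp [h]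
  rw [hsum] at hle
  have h3 : (I.card : ENNReal) * ENNReal.ofReal (1 / m.factorial) ≤ 1 := by
    refine le_trans ?_ hle
    rw [← nsmul_eq_mul]
    exact Finset.card_nsmul_le_sum _ _ _ fun k hk =>
      volume_convexHull_ge (h01 k hk) (hne k hk) (hT k hk)
  have hpos : (0 : ℝ) < m.factorial := by positivity
  rw [← ENNReal.ofReal_natCast, ← ENNReal.ofReal_mul (by positivity), ENNReal.ofReal_le_one,
    mul_one_div, div_le_one hpos] at h3
  exact_mod_cast h3

/-! ### Facet inequalities -/

/-- The points of `V` at which the inequality `c ⬝ᵥ x ≤ γ` is tight. -/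
def tight {n : ℕ} (V : Set (Fin n → ℝ)) (c : Fin n → ℝ) (γ : ℝ) : Set (Fin n → ℝ) :=
  {v ∈ V | c ⬝ᵥ v = γ}

/-- `c ⬝ᵥ x ≤ γ` is valid on `V` and its tight points span the whole hyperplane. -/
structure IsFacetInequality {n : ℕ} (V : Set (Fin n → ℝ)) (c : Fin n → ℝ) (γ : ℝ) : Prop where
  le : ∀ v ∈ V, c ⬝ᵥ v ≤ γ
  nonempty : (tight V c γ).Nonempty
  ne_zero : c ≠ 0
  mem_vectorSpan : ∀ y, c ⬝ᵥ y = 0 → y ∈ vectorSpan ℝ (tight V c γ)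

theorem vectorSpan_convexHull {n : ℕ} (V : Set (Fin n → ℝ)) :
    vectorSpan ℝ (convexHull ℝ V) = vectorSpan ℝ V := by
  rw [← direction_affineSpan, affineSpan_convexHull, direction_affineSpan]

theorem map_vectorSpan_linear {n m : ℕ} (f : (Fin n → ℝ) →ₗ[ℝ] (Fin m → ℝ))
    (s : Set (Fin n → ℝ)) : (vectorSpan ℝ s).map f = vectorSpan ℝ (f '' s) :=
  AffineMap.map_vectorSpan (f := f.toAffineMap)

/-- In a convex combination attaining `γ`, the weighted slacks are nonnegative and sum to zero, so
only tight points carry weight. -/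
theorem face_subset_convexHull_tight {n : ℕ} {V : Set (Fin n → ℝ)} {c : Fin n → ℝ} {γ : ℝ}
    (hV : ∀ v ∈ V, c ⬝ᵥ v ≤ γ) :
    {x ∈ convexHull ℝ V | c ⬝ᵥ x = γ} ⊆ convexHull ℝ (tight V c γ) := by
  rintro x ⟨hx, hxγ⟩
  obtain ⟨ι, _, w, z, hw, hw1, hz, rfl⟩ := mem_convexHull_iff_exists_fintype.1 hx
  have hsum : ∑ i, w i * (γ - c ⬝ᵥ z i) = 0 := by
    have : ∑ i, w i * (c ⬝ᵥ z i) = γ := by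
      rw [← hxγ, dotProduct_sum]
      simp [dotProduct_smul]
    simp [mul_sub, ← Finset.sum_mul, hw1, this]
  have hzero := (Finset.sum_eq_zero_iff_of_nonneg fun i _ =>
    mul_nonneg (hw i) (sub_nonneg.2 (hV _ (hz i)))).1 hsum
  classical
  have hfil : ∑ i, w i • z i = ∑ i with w i ≠ 0, w i • z i := by
    rw [Finset.sum_filter_of_ne]
    intro i _ h h0
    simp [h0] at h
  have hfil1 : ∑ i with w i ≠ 0, w i = 1 := by
    rw [Finset.sum_filter_ne_zero, hw1]
  rw [hfil]
  refine (convex_convexHull ℝ _).sum_mem (fun i _ => hw i) hfil1 fun i hi => ?_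
  refine subset_convexHull ℝ _ ⟨hz i, ?_⟩
  have h1 := hzero i (Finset.mem_univ _)
  rcases mul_eq_zero.1 h1 with h | h
  · exact absurd h (Finset.mem_filter.1 hi).2
  · linarith

/-- The directions of the tight points lie in the kernel of `c`, and both spaces have dimension `m`,
so they coincide. -/
theorem exists_isFacetInequality {m : ℕ} {V : Set (Fin (m + 1) → ℝ)} (hV : vectorSpan ℝ V = ⊤)
    {F : Set (Fin (m + 1) → ℝ)} (hF : F ∈ facets (convexHull ℝ V)) :
    ∃ c γ, IsFacetInequality V c γ ∧ F = {x ∈ convexHull ℝ V | c ⬝ᵥ x = γ} := by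
  obtain ⟨⟨c, γ, hc, rfl⟩, k, ⟨hne, hk⟩, -, hP⟩ := hF
  have hcV : ∀ v ∈ V, c ⬝ᵥ v ≤ γ := fun v hv => hc v (subset_convexHull ℝ V hv)
  have hc0 : c ≠ 0 := by
    rintro rfl
    obtain ⟨x, -, hx⟩ := hne
    have : {x ∈ convexHull ℝ V | (0 : Fin (m + 1) → ℝ) ⬝ᵥ x = γ} = convexHull ℝ V := by
      ext y; simp only [zero_dotProduct] at hx; simp [hx]
    rw [this] at hk
    omega
  have hkm : k = m := by
    rw [vectorSpan_convexHull, hV, finrank_top] at hP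
    simpa using hP.symm
  have hsub := face_subset_convexHull_tight hcV
  have hle : vectorSpan ℝ (tight V c γ) ≤ LinearMap.ker (dotProductBilin ℝ ℝ c) := by
    rw [vectorSpan_def, Submodule.span_le]
    rintro _ ⟨x, hx, y, hy, rfl⟩
    simp [dotProduct_sub, hx.2, hy.2]
  have hker : Module.finrank ℝ (LinearMap.ker (dotProductBilin ℝ ℝ c)) ≤ m := by
    have hne : LinearMap.ker (dotProductBilin ℝ ℝ c) ≠ ⊤ := fun h => by
      have h2 : c ∈ LinearMap.ker (dotProductBilin ℝ ℝ c) := h ▸ Submodule.mem_top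
      exact hc0 (dotProduct_self_eq_zero.1 (by simpa using h2))
    have := Submodule.finrank_lt hne
    simp only [Module.finrank_fin_fun] at this
    omega
  have hge : m ≤ Module.finrank ℝ (vectorSpan ℝ (tight V c γ)) := by
    rw [← vectorSpan_convexHull (tight V c γ)]
    exact (hk.trans hkm).ge.trans (Submodule.finrank_mono (vectorSpan_mono ℝ hsub))
  refine ⟨c, γ, ⟨hcV, convexHull_nonempty_iff.1 (hne.mono hsub), hc0, fun y hy => ?_⟩, rfl⟩
  rw [Submodule.eq_of_le_of_finrank_le hle (hker.trans hge)]
  simpa using hy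

theorem IsFacetInequality.smul {n : ℕ} {V : Set (Fin n → ℝ)} {c : Fin n → ℝ} {γ t : ℝ}
    (h : IsFacetInequality V c γ) (ht : 0 < t) : IsFacetInequality V (t • c) (t * γ) := by
  have htight : tight V (t • c) (t * γ) = tight V c γ := by
    ext x; simp [tight, smul_dotProduct, ht.ne']
  refine ⟨fun v hv => ?_, htight ▸ h.nonempty, smul_ne_zero ht.ne' h.ne_zero, fun y hy => ?_⟩
  · simpa [smul_dotProduct] using mul_le_mul_of_nonneg_left (h.le v hv) ht.le
  · rw [htight]
    exact h.mem_vectorSpan y (by simpa [smul_dotProduct, ht.ne'] using hy)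

/-! ### Cells over facets and their separation -/

/-- Forgetting the last coordinate. -/
abbrev forgetLast (m : ℕ) : (Fin (m + 1) → ℝ) →ₗ[ℝ] (Fin m → ℝ) :=
  LinearMap.funLeft ℝ ℝ Fin.castSucc

theorem dotProduct_eq_forgetLast {m : ℕ} (c x : Fin (m + 1) → ℝ) :
    c ⬝ᵥ x = forgetLast m c ⬝ᵥ forgetLast m x + c (Fin.last m) * x (Fin.last m) := by
  simp [dotProduct, Fin.sum_univ_castSucc, LinearMap.funLeft_apply]

theorem forgetLast_snoc {m : ℕ} (y : Fin m → ℝ) (t : ℝ) :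
    forgetLast m (Fin.snoc (α := fun _ => ℝ) y t) = y := by
  ext i; simp [LinearMap.funLeft_apply]

/-- The cube vertices `u` violating a vertical inequality `c ⬝ᵥ x ≤ γ` by exactly one and preceding,
in a fixed well-order, all other vertices violating it. -/
def apexes {m : ℕ} (c : Fin (m + 1) → ℝ) (γ : ℝ) : Set (Fin m → ℝ) :=
  {u | c (Fin.last m) = 0 ∧ (∀ i, u i = 0 ∨ u i = 1) ∧ forgetLast m c ⬝ᵥ u = γ + 1 ∧
    ∀ w : Fin m → ℝ, (∀ i, w i = 0 ∨ w i = 1) → WellOrderingRel w u → forgetLast m c ⬝ᵥ w ≤ γ}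

/-- A scaling of facet inequalities: the last coefficient is `σ`, or the inequality is vertical
and violated by one at its apex. -/
def IsNormalized {m : ℕ} (σ : ℝ) (c : Fin (m + 1) → ℝ) (γ : ℝ) : Prop :=
  c (Fin.last m) = σ ∨ (apexes c γ).Nonempty

/-- The vertices of the cell in `ℝᵐ` attached to a facet of a polytope in `ℝᵐ⁺¹`: the projection of
the facet, or, for vertical facets, a pyramid over it. -/
def cell {m : ℕ} (V : Set (Fin (m + 1) → ℝ)) (c : Fin (m + 1) → ℝ) (γ : ℝ) : Set (Fin m → ℝ) :=
  forgetLast m '' tight V c γ ∪ apexes c γ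

theorem cell_zero_one {m : ℕ} {V : Set (Fin (m + 1) → ℝ)} (h01 : ∀ v ∈ V, ∀ i, v i = 0 ∨ v i = 1)
    (c : Fin (m + 1) → ℝ) (γ : ℝ) : ∀ v ∈ cell V c γ, ∀ i, v i = 0 ∨ v i = 1 := by
  rintro v (⟨x, hx, rfl⟩ | hv) i
  · exact h01 x hx.1 _
  · exact hv.2.1 i

/-- If the last coefficient is nonzero, every direction in `ℝᵐ` lifts to the kernel of `c`. In the
vertical case only the kernel of the projected functional lifts; the direction from the facet to the
apex, on which that functional is `1`, supplies the rest. -/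
theorem vectorSpan_cell {m : ℕ} {V : Set (Fin (m + 1) → ℝ)} {c : Fin (m + 1) → ℝ} {γ σ : ℝ}
    (h : IsFacetInequality V c γ) (hσ : σ ≠ 0) (hn : IsNormalized σ c γ) :
    vectorSpan ℝ (cell V c γ) = ⊤ := by
  have hlift : ∀ x, c ⬝ᵥ x = 0 → forgetLast m x ∈ vectorSpan ℝ (cell V c γ) := fun x hx => by
    refine vectorSpan_mono ℝ Set.subset_union_left ?_
    rw [← map_vectorSpan_linear]
    exact Submodule.mem_map_of_mem (h.mem_vectorSpan x hx)
  refine eq_top_iff.2 fun y _ => ?_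
  rcases hn with hc | ⟨u, hu⟩
  · have := hlift (Fin.snoc (α := fun _ => ℝ) y (-(forgetLast m c ⬝ᵥ y) / σ)) (by
      rw [dotProduct_eq_forgetLast, forgetLast_snoc, hc]
      simp only [Fin.snoc_last]
      field_simp
      ring)
    rwa [forgetLast_snoc] at this
  · obtain ⟨p, hp⟩ := h.nonempty
    have hpγ : forgetLast m c ⬝ᵥ forgetLast m p = γ := by
      have := hp.2
      rwa [dotProduct_eq_forgetLast, hu.1, zero_mul, add_zero] at this
    have hup : u - forgetLast m p ∈ vectorSpan ℝ (cell V c γ) :=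
      vsub_mem_vectorSpan ℝ (Or.inr hu) (Or.inl ⟨p, hp, rfl⟩)
    set s := forgetLast m c ⬝ᵥ y with hs
    have := hlift (Fin.snoc (α := fun _ => ℝ) (y - s • (u - forgetLast m p)) 0) (by
      rw [dotProduct_eq_forgetLast, forgetLast_snoc, hu.1, dotProduct_sub, dotProduct_smul,
        dotProduct_sub, hu.2.2.1, hpγ, ← hs]
      simp)
    rw [forgetLast_snoc] at this
    simpa using Submodule.add_mem _ this (Submodule.smul_mem _ s hup)

theorem apexes_subsingleton {m : ℕ} (c : Fin (m + 1) → ℝ) (γ : ℝ) :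
    (apexes c γ).Subsingleton := by
  intro u hu w hw
  rcases trichotomous_of WellOrderingRel u w with h | h | h
  · linarith [hw.2.2.2 u hu.2.1 h, hu.2.2.1]
  · exact h
  · linarith [hu.2.2.2 w hw.2.1 h, hw.2.2.1]

/-- Cells of distinct facets are separated by hyperplanes. -/
theorem exists_separating {m : ℕ} {V : Set (Fin (m + 1) → ℝ)} {c c' : Fin (m + 1) → ℝ}
    {γ γ' σ : ℝ} (hσ : σ ≠ 0) (h : IsFacetInequality V c γ) (hn : IsNormalized σ c γ)
    (h' : IsFacetInequality V c' γ') (hn' : IsNormalized σ c' γ') (hne : ¬(c = c' ∧ γ = γ')) :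
    ∃ (a : Fin m → ℝ) (b : ℝ), ¬(a = 0 ∧ b = 0) ∧
      (∀ v ∈ cell V c γ, a ⬝ᵥ v ≤ b) ∧ ∀ v ∈ cell V c' γ', b ≤ a ⬝ᵥ v := by
  -- A vertical inequality separates its own cell from one lying on its valid side.
  have hvert : ∀ {c γ c' γ'}, IsFacetInequality V c γ → IsFacetInequality V c' γ' →
      ∀ u' ∈ apexes c' γ', (∀ u ∈ apexes c γ, WellOrderingRel u u') →
      ¬(forgetLast m c' = 0 ∧ γ' = 0) ∧ (∀ v ∈ cell V c γ, forgetLast m c' ⬝ᵥ v ≤ γ') ∧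
        ∀ v ∈ cell V c' γ', γ' ≤ forgetLast m c' ⬝ᵥ v := by
    intro c γ c' γ' h h' u' hu' hlt
    have hval : ∀ x, c' ⬝ᵥ x = forgetLast m c' ⬝ᵥ forgetLast m x := fun x => by
      rw [dotProduct_eq_forgetLast, hu'.1, zero_mul, add_zero]
    refine ⟨?_, ?_, ?_⟩
    · rintro ⟨h1, h2⟩
      have := hu'.2.2.1
      simp [h1, h2] at this
    · rintro v (⟨x, hx, rfl⟩ | hv)
      · rw [← hval]
        exact h'.le x hx.1
      · exact hu'.2.2.2 v hv.2.1 (hlt v hv)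
    · rintro v (⟨x, hx, rfl⟩ | hv)
      · rw [← hval, hx.2]
      · rw [hv.2.2.1]
        linarith
  -- Otherwise the difference of the two inequalities separates.
  have hdiff : c (Fin.last m) = c' (Fin.last m) → apexes c γ = apexes c' γ' →
      ∃ (a : Fin m → ℝ) (b : ℝ), ¬(a = 0 ∧ b = 0) ∧
        (∀ v ∈ cell V c γ, a ⬝ᵥ v ≤ b) ∧ ∀ v ∈ cell V c' γ', b ≤ a ⬝ᵥ v := by
    intro hl hap
    -- Equal last coefficients cancel in the difference. At a common apex both inequalities are
    -- violated by exactly one, so the apex lies on the separating hyperplane.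
    refine ⟨forgetLast m c' - forgetLast m c, γ' - γ, ?_, ?_, ?_⟩
    · rintro ⟨h1, h2⟩
      refine hne ⟨?_, by linarith⟩
      ext i
      refine Fin.lastCases hl (fun j => ?_) i
      have := congrFun h1 j
      simp only [Pi.sub_apply, LinearMap.funLeft_apply, Pi.zero_apply] at this
      linarith
    · rintro v (⟨x, hx, rfl⟩ | hv)
      · have h1 := hx.2
        have h2 := h'.le x hx.1
        rw [dotProduct_eq_forgetLast] at h1 h2
        rw [← hl] at h2
        rw [sub_dotProduct]
        linarith
      · have h1 := hv.2.2.1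
        have h2 := (hap ▸ hv : v ∈ apexes c' γ').2.2.1
        rw [sub_dotProduct]
        linarith
    · rintro v (⟨x, hx, rfl⟩ | hv)
      · have h1 := hx.2
        have h2 := h.le x hx.1
        rw [dotProduct_eq_forgetLast] at h1 h2
        rw [hl] at h2
        rw [sub_dotProduct]
        linarith
      · have h1 := hv.2.2.1
        have h2 := (hap ▸ hv : v ∈ apexes c γ).2.2.1
        rw [sub_dotProduct]
        linarith
  have hempty : ∀ {c : Fin (m + 1) → ℝ} {γ : ℝ}, c (Fin.last m) = σ → apexes c γ = ∅ := by
    intro c γ hc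
    refine Set.eq_empty_of_forall_notMem fun u hu => hσ ?_
    rw [← hc, hu.1]
  have hneg : ∀ {u' : Fin m → ℝ}, u' ∈ apexes c γ → (∀ u ∈ apexes c' γ', WellOrderingRel u u') →
      ∃ (a : Fin m → ℝ) (b : ℝ), ¬(a = 0 ∧ b = 0) ∧
        (∀ v ∈ cell V c γ, a ⬝ᵥ v ≤ b) ∧ ∀ v ∈ cell V c' γ', b ≤ a ⬝ᵥ v := by
    intro u' hu' hlt
    obtain ⟨h1, h2, h3⟩ := hvert h' h u' hu' hlt
    refine ⟨-forgetLast m c, -γ, by simpa using h1, fun v hv => ?_, fun v hv => ?_⟩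
    · simpa using h3 v hv
    · simpa using h2 v hv
  rcases hn with hc | ⟨u, hu⟩ <;> rcases hn' with hc' | ⟨u', hu'⟩
  · exact hdiff (hc.trans hc'.symm) (by rw [hempty hc, hempty hc'])
  · exact ⟨_, _, hvert h h' u' hu' (by simp [hempty hc])⟩
  · exact hneg hu (by simp [hempty hc'])
  -- The earlier apex satisfies the inequality whose apex comes later, so the later one separates.
  · rcases trichotomous_of WellOrderingRel u u' with hr | hr | hr
    · refine ⟨_, _, hvert h h' u' hu' fun w hw => ?_⟩
      rwa [apexes_subsingleton _ _ hw hu]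
    · subst hr
      refine hdiff (hu.1.trans hu'.1.symm) ?_
      rw [(apexes_subsingleton c γ).eq_singleton_of_mem hu,
        (apexes_subsingleton c' γ').eq_singleton_of_mem hu']
    · refine hneg hu fun w hw => ?_
      rwa [apexes_subsingleton _ _ hw hu']

/-! ### Counting facets in full dimension -/

/-- The facets of `convexHull ℝ V` given by a normalized facet inequality. -/
def normalizedFacets {m : ℕ} (V : Set (Fin (m + 1) → ℝ)) (σ : ℝ) : Set (Set (Fin (m + 1) → ℝ)) :=
  {F | ∃ c γ, (IsFacetInequality V c γ ∧ IsNormalized σ c γ) ∧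
    F = {x ∈ convexHull ℝ V | c ⬝ᵥ x = γ}}

theorem encard_normalizedFacets_le {m : ℕ} {V : Set (Fin (m + 1) → ℝ)}
    (h01 : ∀ v ∈ V, ∀ i, v i = 0 ∨ v i = 1) {σ : ℝ} (hσ : σ ≠ 0) :
    (normalizedFacets V σ).encard ≤ m.factorial := by
  by_contra! hlt
  obtain ⟨t, hts, ht⟩ := Set.exists_subset_encard_eq (Order.add_one_le_of_lt hlt)
  have hfin : t.Finite := Set.finite_of_encard_eq_coe (k := m.factorial + 1) (by simpa using ht)
  have hcg : ∀ F : t, ∃ c γ, (IsFacetInequality V c γ ∧ IsNormalized σ c γ) ∧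
    F.1 = {x ∈ convexHull ℝ V | c ⬝ᵥ x = γ} := fun F => hts F.2
  choose c γ hcγ hF using hcg
  have := hfin.fintype
  have hcard := card_le_factorial_of_separated (Finset.univ : Finset t)
    (fun F => cell V (c F) (γ F)) (fun F _ => cell_zero_one h01 _ _)
    (fun F _ => ((hcγ F).1.nonempty.image _).mono Set.subset_union_left)
    (fun F _ => vectorSpan_cell (hcγ F).1 hσ (hcγ F).2)
    (fun F _ G _ hFG => exists_separating hσ (hcγ F).1 (hcγ F).2 (hcγ G).1 (hcγ G).2
      fun hh => hFG (Subtype.ext (by rw [hF F, hF G, hh.1, hh.2])))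
  rw [Finset.card_univ] at hcard
  rw [Set.encard_eq_coe_toFinset_card, Set.toFinset_card] at ht
  have : Fintype.card t = m.factorial + 1 := by exact_mod_cast ht
  omega

/-- A vertical facet inequality valid on the whole cube is a multiple of a cube inequality. -/
theorem exists_coord_of_valid_on_cube {m : ℕ} {V : Set (Fin (m + 1) → ℝ)}
    (h01 : ∀ v ∈ V, ∀ i, v i = 0 ∨ v i = 1) {c : Fin (m + 1) → ℝ} {γ : ℝ}
    (h : IsFacetInequality V c γ) (hc : c (Fin.last m) = 0)
    (hcube : ∀ u : Fin m → ℝ, (∀ i, u i = 0 ∨ u i = 1) → forgetLast m c ⬝ᵥ u ≤ γ) :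
    ∃ (i : Fin m) (ε : Bool), ∀ x, c ⬝ᵥ x = γ ↔ x i.castSucc = if ε then 1 else 0 := by
  obtain ⟨i, hi⟩ : ∃ i : Fin m, c i.castSucc ≠ 0 := by
    by_contra! h0
    exact h.ne_zero (funext fun i => Fin.lastCases hc h0 i)
  have hval : ∀ u : Fin (m + 1) → ℝ, (∀ i, u i = 0 ∨ u i = 1) → c ⬝ᵥ u ≤ γ := fun u hu => by
    rw [dotProduct_eq_forgetLast, hc, zero_mul, add_zero]
    exact hcube _ fun i => hu _
  -- Flipping coordinate `i` of a tight vertex stays in the cube and must not increase `c`, so the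
  -- sign of `c i` fixes that coordinate.
  have hflip : ∀ v ∈ tight V c γ,
      v i.castSucc = if 0 < c i.castSucc then 1 else 0 := by
    intro v hv
    have h1 := hval (Function.update v i.castSucc (1 - v i.castSucc)) fun j => by
      rcases eq_or_ne j i.castSucc with rfl | hj
      · rcases h01 v hv.1 i.castSucc with h | h <;> simp [h]
      · simpa [hj] using h01 v hv.1 j
    have h2 : Function.update v i.castSucc (1 - v i.castSucc) =
        v + Pi.single i.castSucc (1 - 2 * v i.castSucc) := by
      ext j
      rcases eq_or_ne j i.castSucc with rfl | hj
      · simp; ring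
      · simp [hj]
    rw [h2, dotProduct_add, hv.2, dotProduct_single] at h1
    rcases lt_or_gt_of_ne hi with hneg | hpos
    · rw [if_neg hneg.not_gt]
      rcases h01 v hv.1 i.castSucc with h | h
      · exact h
      · rw [h] at h1; linarith
    · rw [if_pos hpos]
      rcases h01 v hv.1 i.castSucc with h | h
      · rw [h] at h1; linarith
      · exact h
  have hker : ∀ y, c ⬝ᵥ y = 0 → y i.castSucc = 0 := by
    have hle : vectorSpan ℝ (tight V c γ) ≤
        LinearMap.ker (LinearMap.proj (R := ℝ) (φ := fun _ : Fin (m + 1) => ℝ) i.castSucc) := by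
      rw [vectorSpan_def, Submodule.span_le]
      rintro _ ⟨x, hx, y, hy, rfl⟩
      simp [hflip x hx, hflip y hy]
    exact fun y hy => by simpa using hle (h.mem_vectorSpan y hy)
  obtain ⟨p, hp⟩ := h.nonempty
  refine ⟨i, decide (0 < c i.castSucc), fun x => ?_⟩
  have hpi := hflip p hp
  simp only [decide_eq_true_eq]
  rw [← hpi]
  constructor
  · intro hx
    have := hker (x - p) (by rw [dotProduct_sub, hx, hp.2, sub_self])
    simpa [sub_eq_zero] using this
  · intro hx
    have hz := hker (x - p - Pi.single i.castSucc ((c ⬝ᵥ (x - p)) / c i.castSucc)) (by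
      rw [dotProduct_sub, dotProduct_single]
      field_simp
      ring)
    have hz' : c ⬝ᵥ (x - p) = 0 := by simpa [hx, hi] using hz
    rw [dotProduct_sub, hp.2] at hz'
    linarith

/-- The sign of the last coefficient decides. Vertical facets that are not cube facets are all
charged to `σ = 1`, so they cost nothing beyond its `m!`. -/
theorem mem_normalizedFacets_or {m : ℕ} {V : Set (Fin (m + 1) → ℝ)}
    (h01 : ∀ v ∈ V, ∀ i, v i = 0 ∨ v i = 1) (hV : vectorSpan ℝ V = ⊤)
    {F : Set (Fin (m + 1) → ℝ)} (hF : F ∈ facets (convexHull ℝ V)) :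
    F ∈ normalizedFacets V 1 ∨ F ∈ normalizedFacets V (-1) ∨
      F ∈ Set.range fun q : Fin m × Bool =>
        {x ∈ convexHull ℝ V | x q.1.castSucc = if q.2 then 1 else 0} := by
  obtain ⟨c, γ, h, rfl⟩ := exists_isFacetInequality hV hF
  have hscale : ∀ {t : ℝ} (σ : ℝ), 0 < t → IsNormalized σ (t • c) (t * γ) →
      {x ∈ convexHull ℝ V | c ⬝ᵥ x = γ} ∈ normalizedFacets V σ := fun {t} σ ht hn =>
    ⟨t • c, t * γ, ⟨h.smul ht, hn⟩, by ext x; simp [smul_dotProduct, ht.ne']⟩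
  rcases lt_trichotomy (c (Fin.last m)) 0 with hl | hl | hl
  · refine Or.inr (Or.inl (hscale (t := -(c (Fin.last m))⁻¹) _ (by simpa using hl) (Or.inl ?_)))
    simp [hl.ne]
  · by_cases hcube : ∀ u : Fin m → ℝ, (∀ i, u i = 0 ∨ u i = 1) → forgetLast m c ⬝ᵥ u ≤ γ
    · obtain ⟨i, ε, hiε⟩ := exists_coord_of_valid_on_cube h01 h hl hcube
      refine Or.inr (Or.inr ⟨(i, ε), ?_⟩)
      ext x
      simp [hiε]
    · let S : Set (Fin m → ℝ) := {u | (∀ i, u i = 0 ∨ u i = 1) ∧ γ < forgetLast m c ⬝ᵥ u}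
      have hS : S.Nonempty := by
        push Not at hcube
        exact hcube
      have hwf : WellFounded (WellOrderingRel (α := Fin m → ℝ)) := IsWellFounded.wf
      obtain ⟨u, ⟨hu, hγu⟩, hmin⟩ := hwf.has_min S hS
      have hpos : 0 < (forgetLast m c ⬝ᵥ u - γ)⁻¹ := inv_pos.2 (sub_pos.2 hγu)
      refine Or.inl (hscale _ hpos (Or.inr ⟨u, by simp [hl], hu, ?_, fun w hw hwu => ?_⟩))
      · rw [map_smul, smul_dotProduct, smul_eq_mul]
        have : forgetLast m c ⬝ᵥ u - γ ≠ 0 := (sub_pos.2 hγu).ne'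
        field_simp
        ring
      · rw [map_smul, smul_dotProduct, smul_eq_mul]
        refine mul_le_mul_of_nonneg_left ?_ hpos.le
        by_contra! hlt
        exact hmin w ⟨hw, hlt⟩ hwu
  · refine Or.inl (hscale (t := (c (Fin.last m))⁻¹) _ (by simpa using hl) (Or.inl ?_))
    simp [hl.ne']

/-- The facet bound for full-dimensional 0/1-polytopes. -/
theorem encard_facets_le_of_vectorSpan_eq_top {m : ℕ} {V : Set (Fin (m + 1) → ℝ)}
    (h01 : ∀ v ∈ V, ∀ i, v i = 0 ∨ v i = 1) (hV : vectorSpan ℝ V = ⊤) :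
    (facets (convexHull ℝ V)).encard ≤ ((2 * m.factorial + 2 * m : ℕ) : ℕ∞) := by
  have hsub : facets (convexHull ℝ V) ⊆ normalizedFacets V 1 ∪ (normalizedFacets V (-1) ∪
      Set.range fun q : Fin m × Bool =>
        {x ∈ convexHull ℝ V | x q.1.castSucc = if q.2 then 1 else 0}) :=
    fun F hF => mem_normalizedFacets_or h01 hV hF
  have hrange : (Set.range fun q : Fin m × Bool =>
      {x ∈ convexHull ℝ V | x q.1.castSucc = if q.2 then 1 else 0}).encard ≤ ((2 * m : ℕ) : ℕ∞) := by
    rw [← Set.image_univ]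
    refine (Set.encard_image_le _ _).trans ?_
    rw [Set.encard_univ, ENat.card_eq_coe_fintype_card]
    simp [mul_comm]
  calc (facets (convexHull ℝ V)).encard ≤ _ := Set.encard_le_encard hsub
    _ ≤ _ := Set.encard_union_le _ _
    _ ≤ (m.factorial : ℕ∞) + (m.factorial + ((2 * m : ℕ) : ℕ∞)) := by
        gcongr
        · exact encard_normalizedFacets_le h01 one_ne_zero
        · refine (Set.encard_union_le _ _).trans ?_
          gcongr
          exact encard_normalizedFacets_le h01 (by norm_num)
    _ = _ := by push_cast; ring

/-! ### Reduction to full dimension -/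

/-- A `d`-dimensional subspace of `ℝⁿ` maps isomorphically onto some coordinate space `ℝᵈ`. -/
theorem exists_injOn_coordinates {n d : ℕ} (W : Submodule ℝ (Fin n → ℝ))
    (hW : Module.finrank ℝ W = d) :
    ∃ e : Fin d → Fin n, Function.Injective ((LinearMap.funLeft ℝ ℝ e).domRestrict W) := by
  let f : Fin n → Module.Dual ℝ W := fun i => (LinearMap.proj i).domRestrict W
  obtain ⟨κ, a, ha, hs, hli⟩ := exists_linearIndependent' ℝ f
  -- The selected coordinate functionals span all coordinate functionals on `W`, so they separate
  -- its points.
  have hzero : ∀ w : W, (∀ k, f (a k) w = 0) → w = 0 := by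
    intro w hw
    have hall : ∀ g ∈ Submodule.span ℝ (Set.range f), g w = 0 := by
      rw [← hs]
      intro g hg
      induction hg using Submodule.span_induction with
      | mem g hg => obtain ⟨k, rfl⟩ := hg; exact hw k
      | zero => rfl
      | add g₁ g₂ _ _ h₁ h₂ => simp [h₁, h₂]
      | smul r g _ h => simp [h]
    ext i
    exact hall (f i) (Submodule.subset_span ⟨i, rfl⟩)
  have : Fintype κ := Fintype.ofInjective a ha
  have hcard : Fintype.card κ ≤ d := by
    have := hli.fintype_card_le_finrank
    rwa [Subspace.dual_finrank_eq, hW] at this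
  have hinj : Function.Injective ((LinearMap.funLeft ℝ ℝ a).domRestrict W) := by
    refine (injective_iff_map_eq_zero _).2 fun w hw => hzero w fun k => ?_
    exact congrFun hw k
  have hcard' : d ≤ Fintype.card κ := by
    simpa [hW] using LinearMap.finrank_le_finrank_of_injective hinj
  let e : Fin d ≃ κ := (Fintype.equivFinOfCardEq (le_antisymm hcard hcard')).symm
  refine ⟨a ∘ e, (injective_iff_map_eq_zero _).2 fun w hw => hzero w fun k => ?_⟩
  have := congrFun hw (e.symm k)
  simpa [LinearMap.funLeft_apply, f] using this

theorem exists_dotProduct_pullback {n d : ℕ} {W : Submodule ℝ (Fin n → ℝ)}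
    (f : (Fin n → ℝ) →ₗ[ℝ] (Fin d → ℝ)) (hf : Function.Injective (f.domRestrict W))
    (c : Fin n → ℝ) : ∃ c' : Fin d → ℝ, ∀ w ∈ W, c' ⬝ᵥ f w = c ⬝ᵥ w := by
  obtain ⟨g, hg⟩ := LinearMap.exists_leftInverse_of_injective _ (LinearMap.ker_eq_bot.2 hf)
  let l : (Fin d → ℝ) →ₗ[ℝ] ℝ := dotProductBilin ℝ ℝ c ∘ₗ W.subtype ∘ₗ g
  refine ⟨fun i => l fun j => if i = j then 1 else 0, fun w hw => ?_⟩
  have h1 : l (f w) = c ⬝ᵥ w := by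
    have : g (f w) = ⟨w, hw⟩ := LinearMap.congr_fun hg ⟨w, hw⟩
    simp [l, this]
  rw [← h1, LinearMap.pi_apply_eq_sum_univ l (f w)]
  exact Finset.sum_congr rfl fun i _ => mul_comm _ _

theorem encard_facets_le_encard_facets_image {n d : ℕ} {P : Set (Fin n → ℝ)}
    (f : (Fin n → ℝ) →ₗ[ℝ] (Fin d → ℝ)) (hf : Function.Injective (f.domRestrict (vectorSpan ℝ P))) :
    (facets P).encard ≤ (facets (f '' P)).encard := by
  have hinj : ∀ x ∈ P, ∀ y ∈ P, f x = f y → x = y := by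
    intro x hx y hy hxy
    have := @hf ⟨x - y, vsub_mem_vectorSpan ℝ hx hy⟩ 0 (by simp [hxy])
    simpa [sub_eq_zero] using congrArg Subtype.val this
  have hfin : ∀ s ⊆ P, Module.finrank ℝ (vectorSpan ℝ (f '' s)) =
      Module.finrank ℝ (vectorSpan ℝ s) := by
    intro s hs
    rw [← map_vectorSpan_linear, ← LinearMap.range_domRestrict]
    refine LinearMap.finrank_range_of_inj ((injective_iff_map_eq_zero _).2 fun w hw => ?_)
    have := (injective_iff_map_eq_zero _).1 hf ⟨w.1, vectorSpan_mono ℝ hs w.2⟩ hw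
    simpa using this
  have hmaps : Set.MapsTo (fun F => f '' F) (facets P) (facets (f '' P)) := by
    rintro _ ⟨⟨c, γ, hc, rfl⟩, k, ⟨hne, hk⟩, hPne, hPk⟩
    refine ⟨?_, k, ⟨hne.image _, (hfin _ fun x hx => hx.1).trans hk⟩, hPne.image _,
      (hfin _ subset_rfl).trans hPk⟩
    obtain ⟨p, hp⟩ := hPne
    obtain ⟨c', hc'⟩ := exists_dotProduct_pullback f hf c
    -- The pulled-back functional agrees with `c` only on directions of `P`; on points it differs by
    -- a constant, read off at `p`.
    have key : ∀ x ∈ P, c' ⬝ᵥ f x = c ⬝ᵥ x + (c' ⬝ᵥ f p - c ⬝ᵥ p) := by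
      intro x hx
      have h1 : c' ⬝ᵥ f (x - p) = c ⬝ᵥ (x - p) :=
        hc' _ (vsub_mem_vectorSpan ℝ hx hp)
      rw [map_sub, dotProduct_sub, dotProduct_sub] at h1
      linarith
    refine ⟨c', γ + (c' ⬝ᵥ f p - c ⬝ᵥ p), ?_, ?_⟩
    · rintro _ ⟨x, hx, rfl⟩
      rw [key x hx]
      linarith [hc x hx]
    · ext y
      constructor
      · rintro ⟨x, ⟨hx, hxγ⟩, rfl⟩
        exact ⟨⟨x, hx, rfl⟩, by rw [key x hx, hxγ]⟩
      · rintro ⟨⟨x, hx, rfl⟩, hy⟩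
        rw [key x hx] at hy
        exact ⟨x, ⟨hx, by linarith⟩, rfl⟩
  refine Set.encard_le_encard_of_injOn hmaps fun F hF G hG hFG => ?_
  have hsub : ∀ {F}, F ∈ facets P → F ⊆ P := by
    rintro _ ⟨⟨c, γ, -, rfl⟩, -⟩ x hx
    exact hx.1
  have hon : Set.InjOn f P := fun x hx y hy => hinj x hx y hy
  exact (hon.image_eq_image_iff (hsub hF) (hsub hG)).1 hFG

end ZeroOne

theorem mainTheorem2 (d : ℕ) (hd : 1 ≤ d) :
    ZeroOne.maxFacets d ≤ ((2 * Nat.factorial (d - 1) + 2 * (d - 1) : ℕ) : ℕ∞) := by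
  obtain ⟨m, rfl⟩ : ∃ m, d = m + 1 := ⟨d - 1, by omega⟩
  rw [Nat.add_sub_cancel]
  refine iSup_le fun n => iSup_le fun P => iSup_le fun hP => iSup_le fun hdim => ?_
  obtain ⟨V, h01, rfl⟩ := hP
  -- Projecting onto coordinates, rather than by an arbitrary isomorphism, keeps the vertices 0/1.
  obtain ⟨e, he⟩ := ZeroOne.exists_injOn_coordinates _ hdim.2
  refine (ZeroOne.encard_facets_le_encard_facets_image _ he).trans ?_
  rw [LinearMap.image_convexHull]
  refine ZeroOne.encard_facets_le_of_vectorSpan_eq_top ?_ ?_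
  · rintro _ ⟨v, hv, rfl⟩ i
    exact h01 v hv _
  · rw [← ZeroOne.map_vectorSpan_linear, ← ZeroOne.vectorSpan_convexHull V,
      ← LinearMap.range_domRestrict]
    refine Submodule.eq_top_of_finrank_eq ?_
    rw [LinearMap.finrank_range_of_inj he, hdim.2]
    simp
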